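/- For a rational number $x$ and an integer $n\ge 0$ let $(x)_n=x(x+1)\cdots(x+n-1)$, with $(x)_0=1$. Let $p$ be an odd prime and $s$ a positive integer such that $p^s\equiv 2\pmod 3$, and let $m=(2p^s-1)/3$ or $m=p^s-1$. Then $$\sum_{k=0}^{m}(6k+1)\frac{(1/3)_k^6}{k!^6}\equiv 10\,p^s\,\frac{(2/3)_{(2p^s-1)/3}^3}{(1)_{(2p^s-1)/3}^3}\pmod{p^{s+5}}.$$ Here the congruence means that both sides are rational numbers whose denominators are not divisible by $p$, and that the numerator of their difference, in lowest terms, is divisible by $p^{s+5}$. -/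

import Mathlib

/-- The shifted factorial `(x)_n = x (x + 1) ⋯ (x + n - 1)` of a rational number `x`. -/
noncomputable def shiftedFactorial (x : ℚ) (n : ℕ) : ℚ :=
  (ascPochhammer ℚ n).eval x

/-- Congruence of rational numbers modulo a positive integer `m`: both numbers have a denominator
(in lowest terms) prime to `m`, and `m` divides the numerator of their difference. For `m = p ^ r`
with `p` prime and `r ≥ 1` this says that `x` and `y` are `p`-integral and that
`x - y ∈ p ^ r ℤ_p`. -/
def RatModEq (m : ℕ) (x y : ℚ) : Prop :=
  x.den.Coprime m ∧ y.den.Coprime m ∧ (m : ℤ) ∣ (x - y).num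

/-!
Put `n = (2 p ^ s - 1) / 3`; the congruence hypothesis forces `p ≡ 2 (mod 3)` and `s` odd.

For `s ≥ 3` both sides are divisible by `p ^ (s + 5)`. A transformation proved by telescoping turns
the left-hand sum into one over `k + r = m`, whose terms are `3 r - 3 k + 1` times a cube of
quotients of shifted factorials. For `1 ≤ i ≤ s` at least one of the following happens: `p ^ i`
divides `3 r - 3 k + 1`, or the power `p ^ i` contributes to the valuation of the quotient; the
second holds for every odd `i`. The cube counts each contribution three times, which for odd
`s ≥ 3` gives at least `s + 5`. The right-hand side is five times the term at `(0, n)`.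

For `s = 1` replace `(3 j + 1) ^ 5 / (3 j + 3) ^ 5` in the summand by
`((3 j + 1) ^ 5 - y) / ((3 j + 3) ^ 5 + y)`. Modulo `3 n + 1 = 2 p` the sum up to `n`, cleared of
denominators, vanishes identically in `y`, because its terms cancel in pairs; so passing from
`y = 0` to `y = (2 p) ^ 5` changes it by a multiple of `p ^ 6` only. At `y = (2 p) ^ 5` the fifth
powers split over the fifth roots of unity, and Dougall's `₇F₆` summation evaluates the sum.
-/

open Finset

section Telescoping

lemma sum_antidiagonal_sub_shift {M : Type*} [AddCommGroup M] (G : ℕ → ℕ → M) (n : ℕ) :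
    ∑ x ∈ antidiagonal n, (G x.1 (x.2 + 1) - G (x.1 + 1) x.2) = G 0 (n + 1) - G (n + 1) 0 := by
  have h₁ := Nat.sum_antidiagonal_succ (n := n) (f := fun x => G x.1 x.2)
  rw [Nat.sum_antidiagonal_succ'] at h₁
  rw [sum_sub_distrib, sub_eq_sub_iff_add_eq_add, add_comm]
  exact h₁

end Telescoping

section PochRatio

/-- The shifted factorial `(x)_n = x (x + 1) ⋯ (x + n - 1)` in an arbitrary commutative
semiring. -/
def risingFactorial {R : Type*} [CommSemiring R] (x : R) (n : ℕ) : R :=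
  ∏ j ∈ range n, (x + j)

/-- The falling factorial `x (x - 1) ⋯ (x - n + 1)`. -/
def fallingFactorial {R : Type*} [CommRing R] (x : R) (n : ℕ) : R :=
  ∏ j ∈ range n, (x - j)

/-- The quotient `(x)_n / (1)_n = (x)_n / n!`. -/
def pochRatio {K : Type*} [Semifield K] (x : K) (n : ℕ) : K :=
  risingFactorial x n / risingFactorial 1 n

lemma risingFactorial_succ {R : Type*} [CommSemiring R] (x : R) (n : ℕ) :
    risingFactorial x (n + 1) = risingFactorial x n * (x + n) :=
  prod_range_succ _ _

lemma risingFactorial_add {R : Type*} [CommSemiring R] (x : R) (m n : ℕ) :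
    risingFactorial x (m + n) = risingFactorial x m * risingFactorial (x + m) n := by
  simp only [risingFactorial, prod_range_add, Nat.cast_add, add_assoc]

lemma risingFactorial_ne_zero {R : Type*} [CommSemiring R] [NoZeroDivisors R] [Nontrivial R] {x : R}
    (hx : ∀ j : ℕ, x + j ≠ 0) (n : ℕ) : risingFactorial x n ≠ 0 :=
  prod_ne_zero_iff.2 fun j _ => hx j

lemma risingFactorial_neg {R : Type*} [CommRing R] (x : R) (n : ℕ) :
    risingFactorial (-x) n = (-1) ^ n * fallingFactorial x n := by
  have h := prod_neg (s := range n) fun j : ℕ => x - (j : R)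
  rw [card_range] at h
  rw [fallingFactorial, ← h]
  exact prod_congr rfl fun j _ => by ring

lemma fallingFactorial_neg {R : Type*} [CommRing R] (x : R) (n : ℕ) :
    fallingFactorial (-x) n = (-1) ^ n * risingFactorial x n := by
  have h := prod_neg (s := range n) fun j : ℕ => x + (j : R)
  rw [card_range] at h
  rw [risingFactorial, ← h]
  exact prod_congr rfl fun j _ => by ring

lemma risingFactorial_mul_fallingFactorial {R : Type*} [CommRing R] {x z : R} {m n : ℕ}
    (hz : z + 1 = x + m + n) :
    risingFactorial x m * fallingFactorial z n = risingFactorial x (m + n) := by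
  rw [risingFactorial_add, fallingFactorial, ← prod_range_reflect (fun j : ℕ => z - (j : R))]
  refine congrArg _ (prod_congr rfl fun j hj => ?_)
  rw [Nat.sub_sub, Nat.cast_sub (by have := mem_range.1 hj; lia), Nat.cast_add, Nat.cast_one]
  linear_combination hz

lemma shiftedFactorial_eq_risingFactorial (x : ℚ) (n : ℕ) :
    shiftedFactorial x n = risingFactorial x n := by
  induction n with
  | zero => simp [shiftedFactorial, risingFactorial]
  | succ n ih =>
    rw [risingFactorial_succ, ← ih, shiftedFactorial, ascPochhammer_succ_eval, shiftedFactorial]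

lemma factorial_eq_risingFactorial_one (R : Type*) [CommSemiring R] (n : ℕ) :
    (n.factorial : R) = risingFactorial 1 n := by
  simp only [← prod_range_add_one_eq_factorial, risingFactorial, Nat.cast_prod, Nat.cast_add,
    Nat.cast_one, add_comm]

lemma pow_mul_risingFactorial_div {K : Type*} [Field K] {d : K} (hd : d ≠ 0) (x : K) (n : ℕ) :
    d ^ n * risingFactorial (x / d) n = ∏ j ∈ range n, (d * j + x) := by
  rw [risingFactorial, pow_eq_prod_const, ← prod_mul_distrib]
  exact prod_congr rfl fun j _ => by field

lemma pochRatio_zero {K : Type*} [Semifield K] (x : K) : pochRatio x 0 = 1 := by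
  simp [pochRatio, risingFactorial]

lemma pochRatio_succ {K : Type*} [Semifield K] (x : K) (n : ℕ) :
    pochRatio x (n + 1) = pochRatio x n * ((x + n) / (1 + n)) := by
  rw [pochRatio, risingFactorial_succ, risingFactorial_succ, mul_div_mul_comm, pochRatio]

lemma pochRatio_pos {x : ℚ} (hx : 0 < x) (n : ℕ) : 0 < pochRatio x n :=
  div_pos (prod_pos fun j _ => by positivity) (prod_pos fun j _ => by positivity)

end PochRatio

section Transformation

/-- The quotient whose cube occurs in the transformed series `sum_pochRatio_pow_six`. -/
def dualBase (k r : ℕ) : ℚ :=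
  pochRatio (4 / 3) (k + r) * pochRatio (1 / 3) k * (pochRatio (2 / 3) r / pochRatio (4 / 3) r)

lemma dualBase_succ_right (k r : ℕ) :
    dualBase k (r + 1) =
      dualBase k r * ((k + r + 4 / 3) / (k + r + 1) * ((r + 2 / 3) / (r + 4 / 3))) := by
  have h := (pochRatio_pos (x := 4 / 3) (by norm_num) r).ne'
  rw [dualBase, dualBase, ← add_assoc, pochRatio_succ, pochRatio_succ, pochRatio_succ]
  push_cast
  field

lemma dualBase_succ_left (k r : ℕ) :
    dualBase (k + 1) r =
      dualBase k r * ((k + r + 4 / 3) / (k + r + 1) * ((k + 1 / 3) / (k + 1))) := by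
  rw [dualBase, dualBase, add_right_comm, pochRatio_succ, pochRatio_succ]
  push_cast
  ring

lemma dualBase_zero_left (r : ℕ) : dualBase 0 r = pochRatio (2 / 3) r := by
  have h := (pochRatio_pos (x := 4 / 3) (by norm_num) r).ne'
  rw [dualBase, pochRatio_zero, zero_add, mul_one, mul_div_cancel₀ _ h]

lemma pochRatio_four_thirds (k : ℕ) :
    pochRatio (4 / 3 : ℚ) k = (3 * k + 1) * pochRatio (1 / 3) k := by
  induction k with
  | zero => simp [pochRatio_zero]
  | succ k ih =>
    rw [pochRatio_succ, pochRatio_succ, ih]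
    push_cast
    field

lemma dualBase_zero_right (k : ℕ) : dualBase k 0 = (3 * k + 1) * pochRatio (1 / 3) k ^ 2 := by
  rw [dualBase, pochRatio_zero, pochRatio_zero, add_zero, pochRatio_four_thirds]
  ring

/-- The term of the transformed series `sum_pochRatio_pow_six`. -/
def dualTerm (k r : ℕ) : ℚ :=
  (3 * r - 3 * k + 1) * dualBase k r ^ 3

/-- The telescoping certificate of `dualTerm`, found by creative telescoping. -/
def dualCert (k r : ℕ) : ℚ :=
  -(3 * k + 6 * r + 2) * (k / (k + r + 1 / 3)) ^ 3 * dualBase k r ^ 3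

lemma dualTerm_succ_right_sub (k r : ℕ) :
    dualTerm k (r + 1) - dualTerm k r = dualCert k (r + 1) - dualCert (k + 1) r := by
  rw [dualTerm, dualTerm, dualCert, dualCert, dualBase_succ_right, dualBase_succ_left]
  push_cast
  field

theorem sum_pochRatio_pow_six (m : ℕ) :
    ∑ k ∈ range (m + 1), (6 * k + 1) * pochRatio (1 / 3 : ℚ) k ^ 6 =
      ∑ x ∈ antidiagonal m, dualTerm x.1 x.2 := by
  induction m with
  | zero => simp [dualTerm, dualBase, pochRatio_zero]
  | succ m ih =>
    have telescoped : ∑ x ∈ antidiagonal m, (dualTerm x.1 (x.2 + 1) - dualTerm x.1 x.2) =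
        dualCert 0 (m + 1) - dualCert (m + 1) 0 := by
      simp only [dualTerm_succ_right_sub, sum_antidiagonal_sub_shift]
    have boundary : dualTerm (m + 1) 0 + (dualCert 0 (m + 1) - dualCert (m + 1) 0) =
        (6 * (m + 1) + 1) * pochRatio (1 / 3) (m + 1) ^ 6 := by
      rw [dualTerm, dualCert, dualCert, dualBase_zero_right]
      push_cast
      field
    rw [sum_range_succ, ih, Nat.sum_antidiagonal_succ', Nat.cast_succ, ← boundary, ← telescoped,
      sum_sub_distrib]
    ring

end Transformation

section PadicMultiples

variable {p : ℕ} [Fact p.Prime]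

/-- The rational numbers in `p ^ n ℤ_(p)`, as an additive group. -/
def padicMultiples (p n : ℕ) [Fact p.Prime] : AddSubgroup ℚ where
  carrier := {x | padicNorm p x ≤ (p : ℚ) ^ (-n : ℤ)}
  zero_mem' := by
    simp only [Set.mem_ofPred_eq, padicNorm.zero]
    positivity
  add_mem' hx hy := padicNorm.nonarchimedean.trans (max_le hx hy)
  neg_mem' {x} hx := (padicNorm.neg x).trans_le hx

lemma mem_padicMultiples {n : ℕ} {x : ℚ} :
    x ∈ padicMultiples p n ↔ padicNorm p x ≤ (p : ℚ) ^ (-n : ℤ) :=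
  Iff.rfl

lemma intCast_mem_padicMultiples {n : ℕ} {z : ℤ} :
    (z : ℚ) ∈ padicMultiples p n ↔ ((p ^ n : ℕ) : ℤ) ∣ z :=
  padicNorm.dvd_iff_norm_le.symm

lemma intCast_mem_padicMultiples_zero (z : ℤ) : (z : ℚ) ∈ padicMultiples p 0 :=
  intCast_mem_padicMultiples.2 (by simp)

lemma mem_padicMultiples_of_le_padicValRat {n : ℕ} {x : ℚ} (hx : x ≠ 0)
    (h : (n : ℤ) ≤ padicValRat p x) : x ∈ padicMultiples p n := by
  rw [mem_padicMultiples, padicNorm.eq_zpow_of_nonzero hx]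
  exact zpow_le_zpow_right₀ (mod_cast (Fact.out : p.Prime).one_le) (neg_le_neg h)

lemma mul_mem_padicMultiples {m n : ℕ} {x y : ℚ} (hx : x ∈ padicMultiples p m)
    (hy : y ∈ padicMultiples p n) : x * y ∈ padicMultiples p (m + n) := by
  have hp : (p : ℚ) ≠ 0 := mod_cast (Fact.out : p.Prime).ne_zero
  rw [mem_padicMultiples, padicNorm.mul, Nat.cast_add, neg_add, zpow_add₀ hp]
  exact mul_le_mul hx hy (padicNorm.nonneg y) (by positivity)

lemma pow_mem_padicMultiples {n : ℕ} {x : ℚ} (hx : x ∈ padicMultiples p n) (e : ℕ) :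
    x ^ e ∈ padicMultiples p (n * e) := by
  induction e with
  | zero => simpa using intCast_mem_padicMultiples_zero (p := p) 1
  | succ e ih => exact pow_succ x e ▸ mul_mem_padicMultiples ih hx

lemma padicMultiples_antitone : Antitone fun n => padicMultiples p n := by
  intro m n hmn x hx
  have hp : (1 : ℚ) ≤ p := mod_cast (Fact.out : p.Prime).one_le
  exact hx.trans (zpow_le_zpow_right₀ hp (by lia))

lemma mul_mem_padicMultiples_iff {n : ℕ} {u x : ℚ} (hu : padicNorm p u = 1) :
    u * x ∈ padicMultiples p n ↔ x ∈ padicMultiples p n := by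
  rw [mem_padicMultiples, mem_padicMultiples, padicNorm.mul, hu, one_mul]

lemma den_coprime_of_mem_padicMultiples {x : ℚ} (hx : x ∈ padicMultiples p 0) :
    x.den.Coprime p := by
  rw [Nat.coprime_comm, (Fact.out : p.Prime).coprime_iff_not_dvd]
  intro hden
  have hden_mem : ((x.den : ℤ) : ℚ) ∈ padicMultiples p 1 :=
    intCast_mem_padicMultiples.2 (by simpa using mod_cast hden)
  have hnum_mem : (x.num : ℚ) ∈ padicMultiples p 1 := by
    simpa using mul_mem_padicMultiples hx hden_mem
  have hnum : p ∣ x.num.natAbs :=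
    Int.natCast_dvd.1 (by simpa using intCast_mem_padicMultiples.1 hnum_mem)
  exact (Fact.out : p.Prime).not_dvd_one (x.reduced ▸ Nat.dvd_gcd hnum hden)

lemma ratModEq_of_mem_padicMultiples {n : ℕ} {x y : ℚ} (hy : y ∈ padicMultiples p 0)
    (hxy : x - y ∈ padicMultiples p n) : RatModEq (p ^ n) x y := by
  have hx : x ∈ padicMultiples p 0 := by
    simpa using add_mem (padicMultiples_antitone n.zero_le hxy) hy
  refine ⟨(den_coprime_of_mem_padicMultiples hx).pow_right n,
    (den_coprime_of_mem_padicMultiples hy).pow_right n, intCast_mem_padicMultiples.1 ?_⟩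
  simpa using mul_mem_padicMultiples hxy (intCast_mem_padicMultiples_zero (x - y).den)

end PadicMultiples

section Valuation

variable {p : ℕ} [Fact p.Prime]

lemma pow_dvd_linear_iff_modEq {d r c i : ℕ} (hd : ¬p ∣ d) (hc : p ^ i ∣ d * c + r) (j : ℕ) :
    p ^ i ∣ d * j + r ↔ j ≡ c [MOD p ^ i] := by
  have hcop := ((Fact.out : p.Prime).coprime_iff_not_dvd.2 hd).pow_left i
  rw [← Nat.modEq_zero_iff_dvd] at hc ⊢
  exact ⟨fun h => Nat.ModEq.cancel_left_of_coprime hcop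
    (Nat.ModEq.add_right_cancel' r (h.trans hc.symm)),
    fun h => ((h.mul_left d).add_right r).trans hc⟩

lemma card_filter_pow_dvd_linear {d r c i : ℕ} (hd : ¬p ∣ d) (hc : c < p ^ i)
    (hdvd : p ^ i ∣ d * c + r) (k : ℕ) :
    #{j ∈ range k | p ^ i ∣ d * j + r} = k / p ^ i + if c < k % p ^ i then 1 else 0 := by
  simp only [pow_dvd_linear_iff_modEq hd hdvd, ← Nat.count_eq_card_filter_range,
    Nat.count_modEq_card k (pow_pos (Fact.out : p.Prime).pos i) c, Nat.mod_eq_of_lt hc]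

lemma factorization_prod_linear {d r b k : ℕ} {c : ℕ → ℕ} (hd : ¬p ∣ d) (hr : 0 < r)
    (hc : ∀ i, c i < p ^ i) (hdvd : ∀ i, p ^ i ∣ d * c i + r) (hb : d * k + r ≤ p ^ b) :
    (∏ j ∈ range k, (d * j + r)).factorization p =
      ∑ i ∈ Ico 1 b, (k / p ^ i + if c i < k % p ^ i then 1 else 0) := by
  have hd0 : 0 < d := Nat.pos_of_ne_zero fun h => hd (h ▸ dvd_zero p)
  have hterm : ∀ j ∈ range k, (d * j + r).factorization p =
      ∑ i ∈ Ico 1 b, if p ^ i ∣ d * j + r then 1 else 0 := by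
    intro j hj
    have hlt : d * j + r < p ^ b := by
      have := Nat.mul_lt_mul_of_pos_left (mem_range.1 hj) hd0
      lia
    rw [Nat.factorization_eq_card_pow_dvd_of_lt Fact.out (by lia) hlt, card_filter]
  rw [Nat.factorization_prod_apply fun j _ => by lia, sum_congr rfl hterm, sum_comm]
  simp only [← card_filter, card_filter_pow_dvd_linear hd (hc _) (hdvd _)]

theorem padicValRat_pochRatio {d r S k : ℕ} {c : ℕ → ℕ} (hd : ¬p ∣ d) (hr : 0 < r)
    (hc : ∀ i, c i < p ^ i) (hdvd : ∀ i, p ^ i ∣ d * c i + r) (hb : d * k + r ≤ p ^ (S + 1)) :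
    padicValRat p (pochRatio (r / d : ℚ) k) =
      ∑ i ∈ Ico 1 (S + 1), if c i < k % p ^ i then 1 else 0 := by
  have hd0 : 0 < d := Nat.pos_of_ne_zero fun h => hd (h ▸ dvd_zero p)
  have hnum0 : ∏ j ∈ range k, (d * j + r) ≠ 0 := prod_ne_zero_iff.2 fun j _ => by lia
  have hratio : pochRatio (r / d : ℚ) k =
      ((∏ j ∈ range k, (d * j + r) : ℕ) : ℚ) / ((d ^ k * k.factorial : ℕ) : ℚ) := by
    have hdQ : (d : ℚ) ≠ 0 := mod_cast hd0.ne'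
    push_cast
    rw [pochRatio, ← pow_mul_risingFactorial_div hdQ, factorial_eq_risingFactorial_one,
      mul_div_mul_left _ _ (pow_ne_zero k hdQ)]
  have hden : padicValNat p (d ^ k * k.factorial) = ∑ i ∈ Ico 1 (S + 1), k / p ^ i := by
    have hlog : Nat.log p k < S + 1 := by
      have := Nat.le_mul_of_pos_left k hd0
      exact Nat.log_lt_of_lt_pow' S.succ_ne_zero (by lia)
    rw [padicValNat.mul (pow_ne_zero k hd0.ne') k.factorial_ne_zero, padicValNat.pow,
      padicValNat.eq_zero_of_not_dvd hd, padicValNat_factorial hlog, mul_zero, zero_add]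
  rw [hratio, padicValRat.div (mod_cast hnum0) (mod_cast by positivity), padicValRat.of_nat,
    padicValRat.of_nat, hden, ← Nat.factorization_def _ Fact.out,
    factorization_prod_linear hd hr hc hdvd hb, sum_add_distrib]
  push_cast
  ring

end Valuation

section DualTerm

/-- The residue of `-1 / 3` modulo `p ^ i`, for `p ≡ 2 (mod 3)`. -/
def negThirdRes (p i : ℕ) : ℕ :=
  ((if Odd i then 2 else 1) * p ^ i - 1) / 3

/-- The contribution of the `i`-th power of `p` to the valuation of `dualBase k r`, where `P` is
that power and `c` the residue of `-1 / 3` modulo it. -/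
def digitVal (P c k r : ℕ) : ℤ :=
  (if c - 1 < (k + r) % P then 1 else 0) + (if c < k % P then 1 else 0) +
    (if P - 1 - c < r % P then 1 else 0) - (if c - 1 < r % P then 1 else 0)

variable {p : ℕ}

lemma pow_mod_three (h2 : p % 3 = 2) (i : ℕ) : p ^ i % 3 = if Odd i then 2 else 1 := by
  rcases i.even_or_odd' with ⟨t, rfl | rfl⟩
  · simp [pow_mul, Nat.pow_mod, h2]
  · simp [pow_succ, pow_mul, Nat.mul_mod, Nat.pow_mod, h2]

lemma three_mul_negThirdRes_add_one (h2 : p % 3 = 2) (i : ℕ) :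
    3 * negThirdRes p i + 1 = if Odd i then 2 * p ^ i else p ^ i := by
  have := pow_mod_three h2 i
  unfold negThirdRes
  split_ifs with hi <;> simp only [hi, if_true, if_false] at this <;> lia

lemma negThirdRes_lt (h2 : p % 3 = 2) (i : ℕ) : negThirdRes p i < p ^ i := by
  have := three_mul_negThirdRes_add_one h2 i
  split_ifs at this <;> lia

lemma not_dvd_three [Fact p.Prime] (h2 : p % 3 = 2) : ¬p ∣ 3 := fun h => by
  have := ((Nat.prime_dvd_prime_iff_eq (Fact.out : p.Prime) Nat.prime_three).1 h)
  lia

lemma pow_dvd_three_mul_negThirdRes_add_one (h2 : p % 3 = 2) (i : ℕ) :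
    p ^ i ∣ 3 * negThirdRes p i + 1 := by
  rw [three_mul_negThirdRes_add_one h2]
  split_ifs
  exacts [Dvd.intro_left 2 rfl, dvd_rfl]

lemma pow_dvd_three_mul_sub_negThirdRes_add_two (h2 : p % 3 = 2) (i : ℕ) :
    p ^ i ∣ 3 * (p ^ i - 1 - negThirdRes p i) + 2 := by
  convert Nat.dvd_sub (Dvd.intro_left 3 rfl) (pow_dvd_three_mul_negThirdRes_add_one h2 i) using 1
  have := negThirdRes_lt h2 i
  lia

lemma padicValRat_pochRatio_one_third [Fact p.Prime] (h2 : p % 3 = 2) {S k : ℕ}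
    (hS : 3 * k + 1 ≤ p ^ (S + 1)) :
    padicValRat p (pochRatio (1 / 3) k) =
      ∑ i ∈ Ico 1 (S + 1), if negThirdRes p i < k % p ^ i then 1 else 0 := by
  simpa using padicValRat_pochRatio (not_dvd_three h2) one_pos (negThirdRes_lt h2)
    (pow_dvd_three_mul_negThirdRes_add_one h2) hS

lemma padicValRat_pochRatio_two_thirds [Fact p.Prime] (h2 : p % 3 = 2) {S k : ℕ}
    (hS : 3 * k + 2 ≤ p ^ (S + 1)) :
    padicValRat p (pochRatio (2 / 3) k) =
      ∑ i ∈ Ico 1 (S + 1), if p ^ i - 1 - negThirdRes p i < k % p ^ i then 1 else 0 := by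
  have hlt := negThirdRes_lt h2
  simpa using padicValRat_pochRatio (not_dvd_three h2) two_pos
    (fun i => by have := hlt i; lia) (pow_dvd_three_mul_sub_negThirdRes_add_two h2) hS

lemma padicValRat_pochRatio_four_thirds [Fact p.Prime] (h2 : p % 3 = 2) {S k : ℕ}
    (hS : 3 * k + 4 ≤ p ^ (S + 1)) :
    padicValRat p (pochRatio (4 / 3) k) =
      ∑ i ∈ Ico 1 (S + 1), if negThirdRes p i - 1 < k % p ^ i then 1 else 0 := by
  have hdvd (i : ℕ) : p ^ i ∣ 3 * (negThirdRes p i - 1) + 4 := by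
    have h := pow_dvd_three_mul_negThirdRes_add_one h2 i
    cases hc : negThirdRes p i with
    | zero => simp_all
    | succ c => simpa [hc, mul_add, add_assoc] using h
  simpa using padicValRat_pochRatio (not_dvd_three h2) four_pos
    (fun i => (Nat.sub_le _ _).trans_lt (negThirdRes_lt h2 i)) hdvd hS

lemma padicValRat_dualBase [Fact p.Prime] (h2 : p % 3 = 2) {S k r : ℕ}
    (hS : 3 * (k + r) + 4 ≤ p ^ (S + 1)) :
    padicValRat p (dualBase k r) =
      ∑ i ∈ Ico 1 (S + 1), digitVal (p ^ i) (negThirdRes p i) k r := by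
  have hne {x : ℚ} (hx : 0 < x) (l : ℕ) : pochRatio x l ≠ 0 := (pochRatio_pos hx l).ne'
  have h₁ := hne (x := 1 / 3) (by norm_num)
  have h₂ := hne (x := 2 / 3) (by norm_num)
  have h₄ := hne (x := 4 / 3) (by norm_num)
  rw [dualBase, padicValRat.mul (mul_ne_zero (h₄ _) (h₁ _)) (div_ne_zero (h₂ _) (h₄ _)),
    padicValRat.mul (h₄ _) (h₁ _), padicValRat.div (h₂ _) (h₄ _),
    padicValRat_pochRatio_one_third h2 (S := S) (by lia),
    padicValRat_pochRatio_two_thirds h2 (S := S) (by lia),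
    padicValRat_pochRatio_four_thirds h2 hS,
    padicValRat_pochRatio_four_thirds h2 (S := S) (k := r) (by lia), ← add_sub_assoc]
  simp only [digitVal, sum_add_distrib, sum_sub_distrib]

lemma digitVal_nonneg_of_lt {P c k r : ℕ} (h : k + r < P) : 0 ≤ digitVal P c k r := by
  rw [digitVal, Nat.mod_eq_of_lt h, Nat.mod_eq_of_lt (by lia : k < P),
    Nat.mod_eq_of_lt (by lia : r < P)]
  lia

/-- A lower bound for `digitVal` at `P = p ^ i` when `3 * (k + r) + 1 = 2 * p ^ s` or
`k + r + 1 = p ^ s`. -/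
def digitBound (p i k r : ℕ) : ℕ :=
  if Even i ∧ (p ^ i : ℤ) ∣ 3 * r - 3 * k + 1 then 0 else 1

lemma digitBound_le_digitVal_of_three_mul_add_one_eq [Fact p.Prime] (h2 : p % 3 = 2)
    {s i k r : ℕ} (hi : 1 ≤ i) (his : i ≤ s) (hm : 3 * (k + r) + 1 = 2 * p ^ s) :
    digitBound p i k r ≤ digitVal (p ^ i) (negThirdRes p i) k r := by
  have hmod : (k + r) % p ^ i = negThirdRes p i := by
    have hdvd : p ^ i ∣ 3 * (k + r) + 1 := hm ▸ (pow_dvd_pow p his).mul_left 2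
    have h := (pow_dvd_linear_iff_modEq (not_dvd_three h2)
      (pow_dvd_three_mul_negThirdRes_add_one h2 i) (k + r)).1 hdvd
    rw [h, Nat.mod_eq_of_lt (negThirdRes_lt h2 i)]
  have hdvd (hk : k % p ^ i = 0) : (p ^ i : ℤ) ∣ 3 * r - 3 * k + 1 := by
    have hz : (3 * r - 3 * k + 1 : ℤ) = 2 * p ^ s - 6 * k := by
      push_cast [← Nat.cast_inj (R := ℤ)] at hm
      linarith
    exact hz ▸ dvd_sub ((pow_dvd_pow _ his).mul_left 2)
      ((mod_cast Nat.dvd_of_mod_eq_zero hk : (p ^ i : ℤ) ∣ k).mul_left 6)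
  have hc := three_mul_negThirdRes_add_one h2 i
  have hP := Nat.one_lt_pow (by lia : i ≠ 0) (by lia : 1 < p)
  have hadd := Nat.add_mod_eq_ite (m := k) (n := r) (k := p ^ i)
  rw [digitBound, digitVal]
  rcases Nat.even_or_odd i with he | ho
  · simp only [he, true_and, Nat.not_odd_iff_even.2 he, if_false] at *
    by_cases hk : k % p ^ i = 0
    · simp only [hdvd hk, if_true]
      lia
    · lia
  · simp only [ho, if_true, Nat.not_even_iff_odd.2 ho, false_and, if_false] at *
    lia

lemma digitBound_le_digitVal_of_add_one_eq [Fact p.Prime] (h2 : p % 3 = 2)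
    {s i k r : ℕ} (hi : 1 ≤ i) (his : i ≤ s) (hm : k + r + 1 = p ^ s) :
    digitBound p i k r ≤ digitVal (p ^ i) (negThirdRes p i) k r := by
  have hc := three_mul_negThirdRes_add_one h2 i
  have hP := Nat.one_lt_pow (by lia : i ≠ 0) (by lia : 1 < p)
  have hmod : (k + r) % p ^ i = p ^ i - 1 := by
    have h := (pow_dvd_linear_iff_modEq (d := 1) (r := 1) (i := i)
      (Fact.out : p.Prime).not_dvd_one (c := p ^ i - 1)
      (by simp [Nat.sub_add_cancel hP.le]) (k + r)).1
        (by rw [one_mul, hm]; exact pow_dvd_pow p his)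
    rw [h, Nat.mod_eq_of_lt (by lia)]
  have hdvd (hr : r % p ^ i = p ^ i - 1 - negThirdRes p i) :
      (p ^ i : ℤ) ∣ 3 * r - 3 * k + 1 := by
    have h := (pow_dvd_linear_iff_modEq (not_dvd_three h2)
      (pow_dvd_three_mul_sub_negThirdRes_add_two h2 i) r).2
        (hr.trans (Nat.mod_eq_of_lt (by lia)).symm)
    have hz : (3 * r - 3 * k + 1 : ℤ) = 2 * (3 * r + 2 : ℕ) - 3 * p ^ s := by
      push_cast [← Nat.cast_inj (R := ℤ)] at hm ⊢
      linarith
    exact hz ▸ dvd_sub ((mod_cast h : (p ^ i : ℤ) ∣ (3 * r + 2 : ℕ)).mul_left 2)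
      ((pow_dvd_pow _ his).mul_left 3)
  have hk := Nat.mod_lt k hP.pos
  have hr := Nat.mod_lt r hP.pos
  have hadd := Nat.add_mod_eq_ite (m := k) (n := r) (k := p ^ i)
  rw [digitBound, digitVal]
  rcases Nat.even_or_odd i with he | ho
  · simp only [he, true_and, Nat.not_odd_iff_even.2 he, if_false] at *
    by_cases hr : r % p ^ i = p ^ i - 1 - negThirdRes p i
    · simp only [hdvd hr, if_true]
      lia
    · lia
  · simp only [ho, if_true, Nat.not_even_iff_odd.2 ho, false_and, if_false] at *
    lia

lemma pow_card_filter_pow_dvd_dvd (q : ℕ) (z : ℤ) (s : ℕ) :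
    ((q ^ #{i ∈ Ico 1 (s + 1) | (q ^ i : ℤ) ∣ z} : ℕ) : ℤ) ∣ z := by
  induction s with
  | zero => simp
  | succ s ih =>
    by_cases h : (q ^ (s + 1) : ℤ) ∣ z
    · push_cast
      refine (pow_dvd_pow _ ?_).trans h
      simpa using card_filter_le (Ico 1 (s + 1 + 1)) fun i => (q ^ i : ℤ) ∣ z
    · rwa [← insert_Ico_right_eq_Ico_add_one (by lia), filter_insert, if_neg h]

lemma dualBase_mem_padicMultiples [Fact p.Prime] (h2 : p % 3 = 2) {s k r : ℕ}
    (hm : 3 * (k + r) + 1 = 2 * p ^ s ∨ k + r + 1 = p ^ s) :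
    dualBase k r ∈ padicMultiples p (∑ i ∈ Ico 1 (s + 1), digitBound p i k r) := by
  have hpos := pow_pos (Fact.out : p.Prime).pos s
  have hpow : 4 * p ^ s ≤ p ^ (s + 2) := by
    rw [pow_add, mul_comm]
    exact Nat.mul_le_mul_left _ (Nat.pow_le_pow_left (Fact.out : p.Prime).two_le 2)
  have hne : dualBase k r ≠ 0 := by
    have h {x : ℚ} (hx : 0 < x) (l : ℕ) := (pochRatio_pos hx l).ne'
    refine mul_ne_zero (mul_ne_zero ?_ ?_) (div_ne_zero ?_ ?_) <;> exact h (by norm_num) _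
  refine mem_padicMultiples_of_le_padicValRat hne ?_
  rw [padicValRat_dualBase h2 (S := s + 1) (by lia), Nat.cast_sum,
    ← sum_Ico_consecutive _ s.succ_pos (Nat.le_succ _)]
  refine le_add_of_le_of_nonneg (sum_le_sum fun i hi => ?_) (sum_nonneg fun i hi => ?_)
  · rw [mem_Ico] at hi
    rcases hm with hm | hm
    · exact digitBound_le_digitVal_of_three_mul_add_one_eq h2 hi.1 (by lia) hm
    · exact digitBound_le_digitVal_of_add_one_eq h2 hi.1 (by lia) hm
  · have := Nat.pow_le_pow_right (Fact.out : p.Prime).pos (Nat.le_of_succ_le (mem_Ico.1 hi).1)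
    exact digitVal_nonneg_of_lt (by lia)

lemma add_five_le_digit_weight {s k r : ℕ} (hs : Odd s) (hs3 : 3 ≤ s) :
    s + 5 ≤ #{i ∈ Ico 1 (s + 1) | ((p : ℤ) ^ i) ∣ 3 * r - 3 * k + 1} +
      (∑ i ∈ Ico 1 (s + 1), digitBound p i k r) * 3 := by
  set e : ℕ → ℕ := fun i =>
    (if (p : ℤ) ^ i ∣ 3 * r - 3 * k + 1 then 1 else 0) + digitBound p i k r * 3
  have he (i : ℕ) : 1 ≤ e i := by
    simp only [e, digitBound]
    grind
  have he_odd {i : ℕ} (hi : Odd i) : 3 ≤ e i := by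
    simp only [e, digitBound]
    grind
  have he_two : 5 ≤ e 1 + e 2 := by
    have : (p : ℤ) ^ 2 ∣ 3 * r - 3 * k + 1 → (p : ℤ) ^ 1 ∣ 3 * r - 3 * k + 1 :=
      (pow_dvd_pow (p : ℤ) one_le_two).trans
    simp only [e, digitBound]
    grind
  obtain ⟨t, rfl⟩ := Nat.exists_eq_add_of_le' hs3
  have hsum : t ≤ ∑ i ∈ Ico 3 (t + 3), e i := by
    simpa using card_nsmul_le_sum (Ico 3 (t + 3)) e 1 fun i _ => he i
  calc t + 3 + 5 ≤ e 1 + (e 2 + ((∑ i ∈ Ico 3 (t + 3), e i) + e (t + 3))) := by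
        have := he_odd hs
        lia
    _ = ∑ i ∈ Ico 1 (t + 3 + 1), e i := by
        rw [← sum_Ico_succ_top (by lia), ← sum_eq_sum_Ico_succ_bot (by lia),
          ← sum_eq_sum_Ico_succ_bot (by lia)]
    _ = _ := by rw [sum_add_distrib, sum_mul, card_filter]

theorem dualTerm_mem_padicMultiples [Fact p.Prime] (h2 : p % 3 = 2) {s k r : ℕ} (hs : Odd s)
    (hs3 : 3 ≤ s) (hm : 3 * (k + r) + 1 = 2 * p ^ s ∨ k + r + 1 = p ^ s) :
    dualTerm k r ∈ padicMultiples p (s + 5) := by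
  have hweight := intCast_mem_padicMultiples.2
    (pow_card_filter_pow_dvd_dvd p (3 * r - 3 * k + 1) s)
  have hterm := mul_mem_padicMultiples hweight
    (pow_mem_padicMultiples (dualBase_mem_padicMultiples h2 hm) 3)
  exact padicMultiples_antitone (add_five_le_digit_weight hs hs3) (by simpa [dualTerm] using hterm)

end DualTerm

section Dougall

variable {K : Type*} [Field K]

/-- The well-poised quotient
`(a)_k (b)_k (c)_k (d)_k / ((1)_k (1 + a - b)_k (1 + a - c)_k (1 + a - d)_k)`. -/
def wellPoised (a b c d : K) (k : ℕ) : K :=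
  ∏ j ∈ range k, (a + j) * (b + j) * (c + j) * (d + j) /
    ((1 + j) * (1 + a - b + j) * (1 + a - c + j) * (1 + a - d + j))

/-- For `k + r = n`, a multiple of the `k`-th term of Dougall's terminating, two-balanced,
very-well-poised `₇F₆(1)` series, with `σ = 1 + 2 a - b - c - d` and `τ = 1 + a - b - c - d`: the
factors `(e)_k (-n)_k / ((1 + a - e)_k (1 + a + n)_k)`, where `e = σ + n`, are absorbed into the
second quotient, `(σ)_n (e)_k` becoming `(σ)_{2k+r}` and so on. -/
def dougallTerm (a b c d : K) (k r : ℕ) : K :=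
  (a + 2 * k) * wellPoised a b c d k *
    (risingFactorial (1 + 2 * a - b - c - d) (2 * k + r) * risingFactorial (1 + a - b - c - d) r /
      (risingFactorial 1 r * risingFactorial a (2 * k + r + 1)))

/-- The value of Dougall's sum `sum_dougallTerm`. -/
def dougallProd (a b c d : K) (n : ℕ) : K :=
  ∏ j ∈ range n, (1 + 2 * a - b - c - d + j) * (1 + a - b - c + j) * (1 + a - b - d + j) *
    (1 + a - c - d + j) / ((1 + j) * (1 + a - b + j) * (1 + a - c + j) * (1 + a - d + j))

/-- The telescoping certificate of `dougallTerm`. The truncated subtraction is harmless: at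
`k = r = 0` the factor `k` vanishes. -/
def dougallCert (a b c d : K) (k r : ℕ) : K :=
  (2 * (k + r) + 2 * a - b - c - d) *
    (k * (a - b + k) * (a - c + k) * (a - d + k) * wellPoised a b c d k) *
    (risingFactorial (1 + 2 * a - b - c - d) (2 * k + r - 1) *
      risingFactorial (1 + a - b - c - d) r / (risingFactorial 1 r * risingFactorial a (2 * k + r)))

lemma dougall_certificate_identity {R : Type*} [CommRing R] (a b c d k r w v : R) :
    (1 + (k + r)) * (1 + a - b + (k + r)) * (1 + a - c + (k + r)) * (1 + a - d + (k + r)) *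
        ((a + 2 * k) * w *
          ((1 + 2 * a - b - c - d + (2 * k + r)) * (1 + a - b - c - d + r) * v)) -
      (1 + 2 * a - b - c - d + (k + r)) * (1 + a - b - c + (k + r)) * (1 + a - b - d + (k + r)) *
        (1 + a - c - d + (k + r)) *
          ((a + 2 * k) * w * ((1 + r) * (a + (2 * k + r + 1)) * v)) =
    (2 * (k + (r + 1)) + 2 * a - b - c - d) *
        (k * (a - b + k) * (a - c + k) * (a - d + k) * w) *
        ((1 + a - b - c - d + r) * (a + (2 * k + r + 1)) * v) -
      (2 * (k + 1 + r) + 2 * a - b - c - d) * ((a + k) * (b + k) * (c + k) * (d + k) * w) *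
        ((1 + 2 * a - b - c - d + (2 * k + r)) * (1 + r) * v) := by
  -- In terms of `a + k`, `a - b + k`, `a - c + k`, `a - d + k` and `r + 1` all factors are short.
  obtain ⟨e, rfl⟩ : ∃ e, a = e - k := ⟨a + k, by ring⟩
  obtain ⟨b, rfl⟩ : ∃ b', b = e - b' := ⟨e - b, by ring⟩
  obtain ⟨c, rfl⟩ : ∃ c', c = e - c' := ⟨e - c, by ring⟩
  obtain ⟨d, rfl⟩ : ∃ d', d = e - d' := ⟨e - d, by ring⟩
  obtain ⟨r, rfl⟩ : ∃ r', r = r' - 1 := ⟨r + 1, by ring⟩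
  ring

lemma risingFactorial_quotient_shifts {x y : K} (hx : ∀ j : ℕ, x + j ≠ 0)
    (hy : ∀ j : ℕ, y + j ≠ 0) (σ τ : K) (l r : ℕ) : ∃ v,
    risingFactorial σ (l + 1) * risingFactorial τ (r + 1) /
        (risingFactorial y (r + 1) * risingFactorial x (l + 2)) = (σ + l) * (τ + r) * v ∧
      risingFactorial σ l * risingFactorial τ r /
        (risingFactorial y r * risingFactorial x (l + 1)) = (y + r) * (x + (l + 1)) * v ∧
      risingFactorial σ l * risingFactorial τ (r + 1) /
        (risingFactorial y (r + 1) * risingFactorial x (l + 1)) = (τ + r) * (x + (l + 1)) * v ∧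
      risingFactorial σ (l + 1) * risingFactorial τ r /
        (risingFactorial y r * risingFactorial x (l + 2)) = (σ + l) * (y + r) * v := by
  have hy_ne := risingFactorial_ne_zero hy r
  have hx_ne := risingFactorial_ne_zero hx l
  have hyr := hy r
  have hxl := hx l
  have hxl_succ := hx (l + 1)
  push_cast at hxl_succ
  refine ⟨risingFactorial σ l * risingFactorial τ r /
    (risingFactorial y (r + 1) * risingFactorial x (l + 2)), ?_, ?_, ?_, ?_⟩ <;>
  · simp only [risingFactorial_succ, Nat.cast_add, Nat.cast_one]
    field

variable [CharZero K] {a b c d : K}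

lemma wellPoised_succ_mul (hb : ∀ j : ℕ, 1 + a - b + j ≠ 0) (hc : ∀ j : ℕ, 1 + a - c + j ≠ 0)
    (hd : ∀ j : ℕ, 1 + a - d + j ≠ 0) (k : ℕ) :
    (k + 1) * (a - b + (k + 1)) * (a - c + (k + 1)) * (a - d + (k + 1)) *
        wellPoised a b c d (k + 1) =
      (a + k) * (b + k) * (c + k) * (d + k) * wellPoised a b c d k := by
  have hden : (1 + k : K) * (1 + a - b + k) * (1 + a - c + k) * (1 + a - d + k) ≠ 0 :=
    mul_ne_zero (mul_ne_zero (mul_ne_zero (by rw [add_comm]; exact k.cast_add_one_ne_zero) (hb k))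
      (hc k)) (hd k)
  have hfactors : (k + 1 : K) * (a - b + (k + 1)) * (a - c + (k + 1)) * (a - d + (k + 1)) =
      (1 + k) * (1 + a - b + k) * (1 + a - c + k) * (1 + a - d + k) := by ring
  rw [hfactors, wellPoised, prod_range_succ, mul_left_comm, mul_div_cancel₀ _ hden, mul_comm,
    wellPoised]

lemma dougallTerm_recurrence (ha : ∀ j : ℕ, a + j ≠ 0) (hb : ∀ j : ℕ, 1 + a - b + j ≠ 0)
    (hc : ∀ j : ℕ, 1 + a - c + j ≠ 0) (hd : ∀ j : ℕ, 1 + a - d + j ≠ 0) (k r : ℕ) :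
    (1 + (k + r)) * (1 + a - b + (k + r)) * (1 + a - c + (k + r)) * (1 + a - d + (k + r)) *
        dougallTerm a b c d k (r + 1) -
      (1 + 2 * a - b - c - d + (k + r)) * (1 + a - b - c + (k + r)) *
        (1 + a - b - d + (k + r)) * (1 + a - c - d + (k + r)) * dougallTerm a b c d k r =
    dougallCert a b c d k (r + 1) - dougallCert a b c d (k + 1) r := by
  have hone (j : ℕ) : (1 : K) + j ≠ 0 := by rw [add_comm]; exact j.cast_add_one_ne_zero
  obtain ⟨v, h_right, h_base, h_cert, h_left⟩ := risingFactorial_quotient_shifts ha hone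
    (1 + 2 * a - b - c - d) (1 + a - b - c - d) (2 * k + r) r
  simp only [dougallTerm, dougallCert, ← Nat.add_assoc, mul_add_one, Nat.add_sub_cancel]
  rw [add_right_comm (2 * k) 2 r, show 2 * k + r + 2 - 1 = 2 * k + r + 1 from rfl,
    show 2 * k + r + 1 + 1 = 2 * k + r + 2 from rfl, h_right, h_base, h_cert, h_left]
  have hw := wellPoised_succ_mul hb hc hd k
  push_cast
  rw [hw]
  exact dougall_certificate_identity a b c d k r (wellPoised a b c d k) v

theorem sum_dougallTerm (ha : ∀ j : ℕ, a + j ≠ 0) (hb : ∀ j : ℕ, 1 + a - b + j ≠ 0)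
    (hc : ∀ j : ℕ, 1 + a - c + j ≠ 0) (hd : ∀ j : ℕ, 1 + a - d + j ≠ 0) (n : ℕ) :
    ∑ x ∈ antidiagonal n, dougallTerm a b c d x.1 x.2 = dougallProd a b c d n := by
  induction n with
  | zero =>
    have ha₀ : a ≠ 0 := by simpa using ha 0
    simp [dougallTerm, dougallProd, wellPoised, risingFactorial, ha₀]
  | succ n ih =>
    set c₁ : K := (1 + n) * (1 + a - b + n) * (1 + a - c + n) * (1 + a - d + n) with hc₁_def
    set c₀ : K := (1 + 2 * a - b - c - d + n) * (1 + a - b - c + n) * (1 + a - b - d + n) *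
      (1 + a - c - d + n) with hc₀_def
    have hc₁ : c₁ ≠ 0 :=
      mul_ne_zero (mul_ne_zero (mul_ne_zero (by rw [add_comm]; exact n.cast_add_one_ne_zero)
        (hb n)) (hc n)) (hd n)
    have telescoped : ∑ x ∈ antidiagonal n,
        (c₁ * dougallTerm a b c d x.1 (x.2 + 1) - c₀ * dougallTerm a b c d x.1 x.2) =
          -dougallCert a b c d (n + 1) 0 := by
      have cert_zero : dougallCert a b c d 0 (n + 1) = 0 := by simp [dougallCert]
      rw [← zero_sub, ← cert_zero, ← sum_antidiagonal_sub_shift]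
      refine sum_congr rfl fun x hx => ?_
      rw [← dougallTerm_recurrence ha hb hc hd, hc₁_def, hc₀_def, ← mem_antidiagonal.1 hx,
        Nat.cast_add]
    have boundary : c₁ * dougallTerm a b c d (n + 1) 0 = dougallCert a b c d (n + 1) 0 := by
      have ha_last := ha (2 * (n + 1))
      have ha_ne := risingFactorial_ne_zero ha (2 * (n + 1))
      simp only [hc₁_def, dougallTerm, dougallCert, risingFactorial_succ a (2 * (n + 1)), add_zero,
        show 2 * (n + 1) - 1 = 2 * n + 1 from rfl,
        show risingFactorial (1 + 2 * a - b - c - d) (2 * (n + 1)) = _ from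
          risingFactorial_succ _ (2 * n + 1)]
      push_cast at ha_last ⊢
      field
    rw [sum_sub_distrib, ← mul_sum, ← mul_sum, ih] at telescoped
    have prod_succ : c₁ * dougallProd a b c d (n + 1) = c₀ * dougallProd a b c d n := by
      rw [dougallProd, prod_range_succ, mul_left_comm, mul_div_cancel₀ _ hc₁, mul_comm,
        dougallProd]
    rw [Nat.sum_antidiagonal_succ']
    refine mul_left_cancel₀ hc₁ ?_
    linear_combination telescoped + boundary - prod_succ

end Dougall

section ClearedDougall

variable {K : Type*} [Field K] [CharZero K] {a b c d e : K}

lemma dougallTerm_mul_denominators (ha : ∀ j : ℕ, a + j ≠ 0) (hb : ∀ j : ℕ, 1 + a - b + j ≠ 0)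
    (hc : ∀ j : ℕ, 1 + a - c + j ≠ 0) (hd : ∀ j : ℕ, 1 + a - d + j ≠ 0) (k r : ℕ) :
    dougallTerm a b c d k r *
        (risingFactorial 1 k * risingFactorial (1 + a - b) k * risingFactorial (1 + a - c) k *
          risingFactorial (1 + a - d) k *
            (risingFactorial 1 r * risingFactorial a (2 * k + r + 1))) =
      (a + 2 * k) * (risingFactorial a k * risingFactorial b k * risingFactorial c k *
        risingFactorial d k) * (risingFactorial (1 + 2 * a - b - c - d) (2 * k + r) *
          risingFactorial (1 + a - b - c - d) r) := by
  have hone (j : ℕ) : (1 : K) + j ≠ 0 := by rw [add_comm]; exact j.cast_add_one_ne_zero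
  have h_well : wellPoised a b c d k =
      risingFactorial a k * risingFactorial b k * risingFactorial c k * risingFactorial d k /
        (risingFactorial 1 k * risingFactorial (1 + a - b) k * risingFactorial (1 + a - c) k *
          risingFactorial (1 + a - d) k) := by
    simp only [wellPoised, risingFactorial, prod_div_distrib, prod_mul_distrib]
  have hk := mul_ne_zero (mul_ne_zero (mul_ne_zero (risingFactorial_ne_zero hone k)
    (risingFactorial_ne_zero hb k)) (risingFactorial_ne_zero hc k)) (risingFactorial_ne_zero hd k)
  have hr := mul_ne_zero (risingFactorial_ne_zero hone r)
    (risingFactorial_ne_zero ha (2 * k + r + 1))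
  rw [dougallTerm, h_well, mul_mul_mul_comm, mul_assoc _ (_ / _) _, div_mul_cancel₀ _ hk,
    div_mul_cancel₀ _ hr]

/-- The `k`-th term, for `k + r = n`, of Dougall's sum cleared of denominators; the parameters of
the sum satisfy `e = 1 + 2 a - b - c - d + n`. -/
def clearedDougallTerm (a b c d e : K) (k r : ℕ) : K :=
  (a + 2 * k) *
    (risingFactorial a k * risingFactorial b k * risingFactorial c k * risingFactorial d k *
      risingFactorial e k * risingFactorial (-(k + r : K)) k) *
    (fallingFactorial (k + r : K) r * fallingFactorial (a - b + (k + r)) r *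
      fallingFactorial (a - c + (k + r)) r * fallingFactorial (a - d + (k + r)) r *
      fallingFactorial (a - e + (k + r)) r * fallingFactorial (a + 2 * (k + r)) r)

lemma clearedDougallTerm_eq (ha : ∀ j : ℕ, a + j ≠ 0) (hb : ∀ j : ℕ, 1 + a - b + j ≠ 0)
    (hc : ∀ j : ℕ, 1 + a - c + j ≠ 0) (hd : ∀ j : ℕ, 1 + a - d + j ≠ 0) {k r : ℕ}
    (he : e = 1 + 2 * a - b - c - d + (k + r)) :
    risingFactorial (1 + 2 * a - b - c - d) (k + r) * clearedDougallTerm a b c d e k r =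
      (-1) ^ (k + r) * risingFactorial 1 (k + r) ^ 2 * risingFactorial (1 + a - b) (k + r) *
        risingFactorial (1 + a - c) (k + r) * risingFactorial (1 + a - d) (k + r) *
        risingFactorial a (2 * (k + r) + 1) * dougallTerm a b c d k r := by
  have h_one : risingFactorial 1 k * fallingFactorial ((k : K) + r) r = risingFactorial 1 (k + r) :=
    risingFactorial_mul_fallingFactorial (by ring)
  have h_one' : risingFactorial 1 r * fallingFactorial ((k : K) + r) k =
      risingFactorial 1 (k + r) := by
    rw [add_comm k r]; exact risingFactorial_mul_fallingFactorial (by ring)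
  have h_b : risingFactorial (1 + a - b) k * fallingFactorial (a - b + (k + r)) r =
      risingFactorial (1 + a - b) (k + r) := risingFactorial_mul_fallingFactorial (by ring)
  have h_c : risingFactorial (1 + a - c) k * fallingFactorial (a - c + (k + r)) r =
      risingFactorial (1 + a - c) (k + r) := risingFactorial_mul_fallingFactorial (by ring)
  have h_d : risingFactorial (1 + a - d) k * fallingFactorial (a - d + (k + r)) r =
      risingFactorial (1 + a - d) (k + r) := risingFactorial_mul_fallingFactorial (by ring)
  have h_a : risingFactorial a (2 * k + r + 1) * fallingFactorial (a + 2 * (k + r)) r =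
      risingFactorial a (2 * (k + r) + 1) := by
    rw [show 2 * (k + r) + 1 = 2 * k + r + 1 + r by ring]
    exact risingFactorial_mul_fallingFactorial (by push_cast; ring)
  have h_e : risingFactorial (1 + 2 * a - b - c - d) (k + r) * risingFactorial e k =
      risingFactorial (1 + 2 * a - b - c - d) (2 * k + r) := by
    rw [he, ← Nat.cast_add, ← risingFactorial_add]; congr 1; ring
  have h_τ : fallingFactorial (a - e + (k + r)) r =
      (-1) ^ r * risingFactorial (1 + a - b - c - d) r := by
    rw [← fallingFactorial_neg, he]; congr 1; ring
  have h_term := dougallTerm_mul_denominators ha hb hc hd k r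
  rw [← h_e] at h_term
  rw [clearedDougallTerm, risingFactorial_neg, h_τ, ← h_a, ← h_b, ← h_c, ← h_d, pow_two, pow_add]
  nth_rw 1 [← h_one]
  rw [← h_one']
  linear_combination -((-1) ^ k * (-1) ^ r * fallingFactorial ((k : K) + r) k *
    fallingFactorial ((k : K) + r) r * fallingFactorial (a - b + (k + r)) r *
    fallingFactorial (a - c + (k + r)) r * fallingFactorial (a - d + (k + r)) r *
    fallingFactorial (a + 2 * (k + r)) r) * h_term

theorem sum_clearedDougallTerm (ha : ∀ j : ℕ, a + j ≠ 0) (hb : ∀ j : ℕ, 1 + a - b + j ≠ 0)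
    (hc : ∀ j : ℕ, 1 + a - c + j ≠ 0) (hd : ∀ j : ℕ, 1 + a - d + j ≠ 0) {n : ℕ}
    (he : e = 1 + 2 * a - b - c - d + n)
    (hσ : ∀ j < n, 1 + 2 * a - b - c - d + j ≠ 0) :
    ∑ x ∈ antidiagonal n, clearedDougallTerm a b c d e x.1 x.2 =
      (-1) ^ n * risingFactorial 1 n * risingFactorial a (2 * n + 1) *
        (risingFactorial (1 + a - b - c) n * risingFactorial (1 + a - b - d) n *
          risingFactorial (1 + a - c - d) n) := by
  have hone (j : ℕ) : (1 : K) + j ≠ 0 := by rw [add_comm]; exact j.cast_add_one_ne_zero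
  have h_prod : dougallProd a b c d n = risingFactorial (1 + 2 * a - b - c - d) n *
      risingFactorial (1 + a - b - c) n * risingFactorial (1 + a - b - d) n *
        risingFactorial (1 + a - c - d) n / (risingFactorial 1 n * risingFactorial (1 + a - b) n *
          risingFactorial (1 + a - c) n * risingFactorial (1 + a - d) n) := by
    simp only [dougallProd, risingFactorial, prod_div_distrib, prod_mul_distrib]
  have h_den := mul_ne_zero (mul_ne_zero (mul_ne_zero (risingFactorial_ne_zero hone n)
    (risingFactorial_ne_zero hb n)) (risingFactorial_ne_zero hc n)) (risingFactorial_ne_zero hd n)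
  have hσ_ne : risingFactorial (1 + 2 * a - b - c - d) n ≠ 0 :=
    prod_ne_zero_iff.2 fun j hj => hσ j (mem_range.1 hj)
  have h_sum : risingFactorial (1 + 2 * a - b - c - d) n *
      ∑ x ∈ antidiagonal n, clearedDougallTerm a b c d e x.1 x.2 =
        (-1) ^ n * risingFactorial 1 n ^ 2 * risingFactorial (1 + a - b) n *
          risingFactorial (1 + a - c) n * risingFactorial (1 + a - d) n *
          risingFactorial a (2 * n + 1) * dougallProd a b c d n := by
    rw [← sum_dougallTerm ha hb hc hd, mul_sum, mul_sum]
    refine sum_congr rfl fun x hx => ?_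
    obtain rfl := mem_antidiagonal.1 hx
    exact clearedDougallTerm_eq ha hb hc hd (by rw [he, Nat.cast_add])
  refine mul_left_cancel₀ hσ_ne ?_
  rw [h_sum]
  rw [eq_div_iff h_den] at h_prod
  linear_combination ((-1) ^ n * risingFactorial 1 n * risingFactorial a (2 * n + 1)) * h_prod

end ClearedDougall

section FifthRoots

variable {R : Type*} [CommRing R] {ζ : R}

lemma fifthRoot_trace_sq (hζ : 1 + ζ + ζ ^ 2 + ζ ^ 3 + ζ ^ 4 = 0) :
    (ζ + ζ ^ 4) ^ 2 = 1 - (ζ + ζ ^ 4) := by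
  have ζ_pow : ζ ^ 5 = 1 := by linear_combination (ζ - 1) * hζ
  linear_combination hζ + (ζ ^ 3 + 2) * ζ_pow

lemma prod_sub_fifth_roots (hζ : 1 + ζ + ζ ^ 2 + ζ ^ 3 + ζ ^ 4 = 0) (X w : R) :
    (X - w * ζ) * (X - w * ζ ^ 2) * (X - w * ζ ^ 3) * (X - w * ζ ^ 4) * (X - w) =
      X ^ 5 - w ^ 5 := by
  have ζ_pow : ζ ^ 5 = 1 := by linear_combination (ζ - 1) * hζ
  have pair_outer : (X - w * ζ) * (X - w * ζ ^ 4) = X ^ 2 - w * (ζ + ζ ^ 4) * X + w ^ 2 := by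
    linear_combination w ^ 2 * ζ_pow
  have pair_inner : (X - w * ζ ^ 2) * (X - w * ζ ^ 3) =
      X ^ 2 - w * (-1 - (ζ + ζ ^ 4)) * X + w ^ 2 := by
    linear_combination w ^ 2 * ζ_pow - w * X * hζ
  calc _ = ((X - w * ζ) * (X - w * ζ ^ 4)) * ((X - w * ζ ^ 2) * (X - w * ζ ^ 3)) * (X - w) := by
        ring
    _ = X ^ 5 - w ^ 5 := by
        rw [pair_outer, pair_inner]
        linear_combination (-w ^ 2 * X ^ 2 * (X - w)) * fifthRoot_trace_sq hζ

/-- The product of the three linear factors that Dougall's formula produces from the parameters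
`(1 - 2 c ζ ^ i) / 3`. -/
def resolventFactor (ζ c X : R) : R :=
  (X + c * (1 + 2 * ζ + 2 * ζ ^ 2)) * (X + c * (1 + 2 * ζ + 2 * ζ ^ 3)) *
    (X + c * (1 + 2 * ζ ^ 2 + 2 * ζ ^ 3))

lemma resolventFactor_zero (hζ : 1 + ζ + ζ ^ 2 + ζ ^ 3 + ζ ^ 4 = 0) (c : R) :
    resolventFactor ζ c 0 = 5 * c ^ 3 := by
  have ζ_pow : ζ ^ 5 = 1 := by linear_combination (ζ - 1) * hζ
  have mul_eq : (1 + 2 * ζ + 2 * ζ ^ 2) * (1 + 2 * ζ + 2 * ζ ^ 3) = 1 + 2 * ζ ^ 2 + 2 * ζ ^ 3 := by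
    linear_combination 4 * hζ + 4 * ζ_pow
  have sq_eq : (1 + 2 * ζ ^ 2 + 2 * ζ ^ 3) ^ 2 = 5 := by
    linear_combination 4 * hζ + (4 * ζ + 8) * ζ_pow
  rw [resolventFactor]
  linear_combination c ^ 3 * (1 + 2 * ζ ^ 2 + 2 * ζ ^ 3) * mul_eq + c ^ 3 * sq_eq

lemma resolventFactor_mul_neg (hζ : 1 + ζ + ζ ^ 2 + ζ ^ 3 + ζ ^ 4 = 0) (c X : R) :
    resolventFactor ζ c X * resolventFactor ζ c (-X) =
      -((X ^ 2 - 5 * c ^ 2) * (X ^ 4 + 10 * c ^ 2 * X ^ 2 + 5 * c ^ 4)) := by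
  have ζ_pow : ζ ^ 5 = 1 := by linear_combination (ζ - 1) * hζ
  have sq₁ : (1 + 2 * ζ + 2 * ζ ^ 2) ^ 2 = -7 - 4 * (ζ + ζ ^ 4) := by
    linear_combination (8 : R) * hζ
  have sq₂ : (1 + 2 * ζ + 2 * ζ ^ 3) ^ 2 = -3 + 4 * (ζ + ζ ^ 4) := by
    linear_combination 4 * hζ + 4 * ζ * ζ_pow
  have sq₃ : (1 + 2 * ζ ^ 2 + 2 * ζ ^ 3) ^ 2 = 5 := by
    linear_combination 4 * hζ + (4 * ζ + 8) * ζ_pow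
  calc _ = (c ^ 2 * (1 + 2 * ζ + 2 * ζ ^ 2) ^ 2 - X ^ 2) *
        (c ^ 2 * (1 + 2 * ζ + 2 * ζ ^ 3) ^ 2 - X ^ 2) *
        (c ^ 2 * (1 + 2 * ζ ^ 2 + 2 * ζ ^ 3) ^ 2 - X ^ 2) := by
        simp only [resolventFactor]; ring
    _ = _ := by
        rw [sq₁, sq₂, sq₃]
        linear_combination (-16 * c ^ 4 * (5 * c ^ 2 - X ^ 2)) * fifthRoot_trace_sq hζ

lemma intCast_ne_mul_fifth_root [CharZero R] {η : R} (hη : η ^ 5 = 1) {x w : ℤ} (hxw : x ≠ w) :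
    (x : R) ≠ w * η := by
  intro h
  have h_pow : x ^ 5 = w ^ 5 := by
    exact_mod_cast (by rw [h, mul_pow, hη, mul_one] : (x : R) ^ 5 = (w : R) ^ 5)
  exact hxw ((Odd.strictMono_pow (by decide : Odd 5)).injective h_pow)

end FifthRoots

section DeformedSum

variable {R : Type*} [CommRing R]

/-- For `k + r = n`, a multiple of the `k`-th term of the very-well-poised series obtained from
`∑ (6 k + 1) (1/3)_k ^ 6 / (1)_k ^ 6` by truncating it after `n` and replacing
`(3 j + 1) ^ 5 / (3 j + 3) ^ 5` by `((3 j + 1) ^ 5 - y) / ((3 j + 3) ^ 5 + y)`; the common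
denominator has been cleared. -/
def deformedTerm (y : R) (k r : ℕ) : R :=
  (6 * k + 1) * (∏ j ∈ range k, (3 * j + 1) * ((3 * j + 1) ^ 5 - y)) *
    ∏ j ∈ range r, 3 * ((k + r : R) - j) * ((3 * ((k + r : R) - j)) ^ 5 + y)

/-- The cleared sum of the deformed series. -/
def deformedSum (n : ℕ) (y : R) : R :=
  ∑ x ∈ antidiagonal n, deformedTerm y x.1 x.2

lemma map_deformedSum {S : Type*} [CommRing S] (f : R →+* S) (n : ℕ) (y : R) :
    f (deformedSum n y) = deformedSum n (f y) := by
  simp only [deformedSum, deformedTerm, map_sum, map_mul, map_prod, map_add, map_sub, map_pow,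
    map_natCast, map_ofNat, map_one]

-- Modulo `3 n + 1` the terms at `(k, r)` and `(r, k)` are opposite to each other.
lemma deformedSum_eq_zero {n : ℕ} (hn : (3 * n + 1 : R) = 0) (y : R) : deformedSum n y = 0 := by
  let q (k : ℕ) : R := ∏ j ∈ range k, 3 * ((n : R) - j) * ((3 * ((n : R) - j)) ^ 5 + y)
  have term_eq (x : ℕ × ℕ) (hx : x ∈ antidiagonal n) :
      deformedTerm y x.1 x.2 = 3 * x.1 * (q x.1 * q x.2) - 3 * x.2 * (q x.1 * q x.2) := by
    have hx' : (x.1 + x.2 : R) = n := by rw [← mem_antidiagonal.1 hx, Nat.cast_add]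
    have left_prod : ∏ j ∈ range x.1, (3 * (j : R) + 1) * ((3 * j + 1) ^ 5 - y) = q x.1 := by
      refine prod_congr rfl fun j _ => ?_
      rw [show (3 * j + 1 : R) = -(3 * (n - j)) by linear_combination hn]
      ring
    rw [deformedTerm, left_prod, hx']
    linear_combination (q x.1 * q x.2) * (3 * hx' + hn)
  rw [deformedSum, sum_congr rfl term_eq, sum_sub_distrib, sub_eq_zero,
    ← Nat.sum_antidiagonal_swap]
  exact sum_congr rfl fun x _ => by rw [Prod.fst_swap, Prod.snd_swap, mul_comm (q x.2)]

lemma mul_dvd_deformedSum_sub (n : ℕ) (y : ℤ) :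
    (3 * n + 1) * y ∣ deformedSum n y - deformedSum n 0 := by
  have C_dvd : Polynomial.C (3 * n + 1 : ℤ) ∣ deformedSum n (Polynomial.X : Polynomial ℤ) := by
    have map_zero : (deformedSum n (Polynomial.X : Polynomial ℤ)).map
        (Int.castRingHom (ZMod (3 * n + 1))) = 0 := by
      rw [← Polynomial.coe_mapRingHom, map_deformedSum]
      refine deformedSum_eq_zero ?_ _
      exact_mod_cast CharP.cast_eq_zero (Polynomial (ZMod (3 * n + 1))) (3 * n + 1)
    refine Polynomial.C_dvd_iff_dvd_coeff _ _ |>.2 fun i => ?_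
    have h := congrArg (Polynomial.coeff · i) map_zero
    simp only [Polynomial.coeff_map, Polynomial.coeff_zero, eq_intCast,
      ZMod.intCast_zmod_eq_zero_iff_dvd] at h
    exact_mod_cast h
  obtain ⟨G, hG⟩ := C_dvd
  have eval_eq (z : ℤ) : deformedSum n z = (3 * n + 1) * G.eval z := by
    have h := congrArg (Polynomial.evalRingHom z) hG
    rw [map_deformedSum] at h
    simpa using h
  rw [eval_eq, eval_eq, ← mul_sub]
  exact mul_dvd_mul_left _ (by simpa using Polynomial.sub_dvd_eval_sub y 0 G)

end DeformedSum

section ClosedForm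

lemma prod_range_sub_middle {R S : Type*} [Ring R] [CommMonoid S] (f : R → S) (M : ℕ) :
    ∏ j ∈ range (2 * M + 1), f (j - M) = f 0 * ∏ i ∈ range M, (f (i + 1) * f (-(i + 1))) := by
  induction M with
  | zero => simp
  | succ M ih =>
    have shift (j : ℕ) : ((j + 1 : ℕ) : R) - (M + 1 : ℕ) = j - M := by push_cast; abel
    have last : ((2 * M + 1 : ℕ) : R) - M = M + 1 := by push_cast; rw [two_mul]; abel
    have first : ((0 : ℕ) : R) - (M + 1 : ℕ) = -(M + 1) := by push_cast; abel
    rw [show 2 * (M + 1) + 1 = 2 * M + 1 + 1 + 1 by ring, prod_range_succ, prod_range_succ',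
      prod_range_succ _ M, ← mul_assoc (f 0), ← ih]
    simp only [shift, last, first]
    rw [mul_assoc, mul_comm (f (-(M + 1)))]

lemma prod_three_mul_sub_add_middle {R : Type*} [CommRing R] (M : ℕ) (c : R) :
    ∏ j ∈ range (2 * M + 1), (3 * (j - M) + c) = c * ∏ i ∈ range M, (c ^ 2 - (3 * i + 3) ^ 2) := by
  rw [prod_range_sub_middle fun x : R => 3 * x + c, mul_zero, zero_add]
  exact congrArg _ (prod_congr rfl fun i _ => by ring)

lemma prod_resolventFactor_middle {R : Type*} [CommRing R] {ζ : R}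
    (hζ : 1 + ζ + ζ ^ 2 + ζ ^ 3 + ζ ^ 4 = 0) (c : R) (M : ℕ) :
    ∏ j ∈ range (2 * M + 1), resolventFactor ζ c (3 * (j - M)) = 5 * c ^ 3 * ∏ i ∈ range M,
      -(((3 * i + 3) ^ 2 - 5 * c ^ 2) *
        ((3 * i + 3) ^ 4 + 10 * c ^ 2 * (3 * i + 3) ^ 2 + 5 * c ^ 4)) := by
  rw [prod_range_sub_middle fun x : R => resolventFactor ζ c (3 * x), mul_zero,
    resolventFactor_zero hζ]
  refine congrArg _ (prod_congr rfl fun i _ => ?_)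
  rw [mul_neg, resolventFactor_mul_neg hζ, mul_add_one (3 : R)]

variable {K : Type*} [Field K] [CharZero K] {ζ : K}

lemma deformedTerm_fifth_power (hζ : 1 + ζ + ζ ^ 2 + ζ ^ 3 + ζ ^ 4 = 0) {w : K} {k r : ℕ}
    (hw : w = 3 * (k + r) + 1) :
    deformedTerm (w ^ 5) k r = 3 ^ (6 * (k + r) + 1) *
      clearedDougallTerm (1 / 3) ((1 - w * ζ) / 3) ((1 - w * ζ ^ 2) / 3) ((1 - w * ζ ^ 3) / 3)
        ((1 - w * ζ ^ 4) / 3) k r := by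
  have left_prod : ∏ j ∈ range k, (3 * (j : K) + 1) * ((3 * j + 1) ^ 5 - w ^ 5) =
      3 ^ (6 * k) * (risingFactorial (1 / 3) k * risingFactorial ((1 - w * ζ) / 3) k *
        risingFactorial ((1 - w * ζ ^ 2) / 3) k * risingFactorial ((1 - w * ζ ^ 3) / 3) k *
        risingFactorial ((1 - w * ζ ^ 4) / 3) k * risingFactorial (-(k + r : K)) k) := by
    rw [pow_mul, ← card_range k, ← prod_const, card_range]
    simp only [risingFactorial, ← prod_mul_distrib]
    refine prod_congr rfl fun j _ => ?_
    rw [← prod_sub_fifth_roots hζ, show -(k + r : K) = (1 - w) / 3 by linear_combination hw / 3]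
    ring
  have right_prod : ∏ j ∈ range r, 3 * ((k + r : K) - j) * ((3 * ((k + r : K) - j)) ^ 5 + w ^ 5) =
      3 ^ (6 * r) * (fallingFactorial (k + r : K) r *
        fallingFactorial (1 / 3 - (1 - w * ζ) / 3 + (k + r)) r *
        fallingFactorial (1 / 3 - (1 - w * ζ ^ 2) / 3 + (k + r)) r *
        fallingFactorial (1 / 3 - (1 - w * ζ ^ 3) / 3 + (k + r)) r *
        fallingFactorial (1 / 3 - (1 - w * ζ ^ 4) / 3 + (k + r)) r *
        fallingFactorial (1 / 3 + 2 * (k + r) : K) r) := by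
    rw [pow_mul, ← card_range r, ← prod_const, card_range]
    simp only [fallingFactorial, ← prod_mul_distrib]
    refine prod_congr rfl fun j _ => ?_
    rw [show w ^ 5 = -(-w) ^ 5 by ring, ← sub_eq_add_neg, ← prod_sub_fifth_roots hζ,
      show (1 / 3 + 2 * (k + r) : K) = w / 3 + (k + r) by linear_combination -hw / 3]
    ring
  rw [deformedTerm, left_prod, right_prod, clearedDougallTerm, mul_add 6 k r, pow_add, pow_add,
    pow_one]
  generalize (3 : K) ^ (6 * k) = P, (3 : K) ^ (6 * r) = Q
  ring

lemma prod_resolventFactor (ζ c x : K) (n : ℕ) :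
    ∏ j ∈ range n, resolventFactor ζ c (3 * j + x) =
      3 ^ (3 * n) * (risingFactorial ((x + c * (1 + 2 * ζ + 2 * ζ ^ 2)) / 3) n *
        risingFactorial ((x + c * (1 + 2 * ζ + 2 * ζ ^ 3)) / 3) n *
        risingFactorial ((x + c * (1 + 2 * ζ ^ 2 + 2 * ζ ^ 3)) / 3) n) := by
  simp only [resolventFactor, add_assoc, prod_mul_distrib,
    ← pow_mul_risingFactorial_div (three_ne_zero' K)]
  ring

lemma sum_clearedDougallTerm_fifth_roots (hζ : 1 + ζ + ζ ^ 2 + ζ ^ 3 + ζ ^ 4 = 0) {n : ℕ} {w : K}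
    (hw : w = 3 * n + 1) :
    ∑ x ∈ antidiagonal n, clearedDougallTerm (1 / 3) ((1 - w * ζ) / 3) ((1 - w * ζ ^ 2) / 3)
        ((1 - w * ζ ^ 3) / 3) ((1 - w * ζ ^ 4) / 3) x.1 x.2 =
      (-1) ^ n * risingFactorial 1 n * risingFactorial (1 / 3) (2 * n + 1) *
        (risingFactorial ((2 - w / 2 + w / 2 * (1 + 2 * ζ + 2 * ζ ^ 2)) / 3) n *
          risingFactorial ((2 - w / 2 + w / 2 * (1 + 2 * ζ + 2 * ζ ^ 3)) / 3) n *
          risingFactorial ((2 - w / 2 + w / 2 * (1 + 2 * ζ ^ 2 + 2 * ζ ^ 3)) / 3) n) := by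
  have ζ_pow : ζ ^ 5 = 1 := by linear_combination (ζ - 1) * hζ
  have pow_five (i : ℕ) : (ζ ^ i) ^ 5 = 1 := by rw [pow_right_comm, ζ_pow, one_pow]
  have ne_mul (x : ℤ) (hx : x ≠ 3 * n + 1) (i : ℕ) : (x : K) ≠ w * ζ ^ i := by
    rw [show w = (3 * n + 1 : ℤ) by push_cast; exact hw]
    exact intCast_ne_mul_fifth_root (pow_five i) hx
  have base_ne (j : ℕ) : (1 / 3 + j : K) ≠ 0 := fun h =>
    (3 * j).cast_add_one_ne_zero (R := K) (by push_cast; linear_combination 3 * h)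
  have param_ne (i j : ℕ) : 1 + 1 / 3 - (1 - w * ζ ^ i) / 3 + (j : K) ≠ 0 := fun h =>
    ne_mul (-(3 * j + 3)) (by lia) i (by push_cast; linear_combination -3 * h)
  have sigma_ne (j : ℕ) (hj : j < n) : 1 + 2 * (1 / 3) - (1 - w * ζ) / 3 - (1 - w * ζ ^ 2) / 3 -
      (1 - w * ζ ^ 3) / 3 + (j : K) ≠ 0 := fun h =>
    ne_mul (2 + 3 * j - (3 * n + 1)) (by lia) 4
      (by push_cast; linear_combination 3 * h - w * hζ + hw)
  rw [sum_clearedDougallTerm base_ne (by simpa only [pow_one] using param_ne 1) (param_ne 2)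
    (param_ne 3) (by linear_combination -w / 3 * hζ + hw / 3) sigma_ne]
  congr 4 <;> ring

lemma deformedSum_fifth_power (hζ : 1 + ζ + ζ ^ 2 + ζ ^ 3 + ζ ^ 4 = 0) {n : ℕ} {w : K}
    (hw : w = 3 * n + 1) :
    deformedSum n (w ^ 5) = (-1) ^ n * (∏ j ∈ range n, (3 * j + 3 : K)) *
      (∏ j ∈ range (2 * n + 1), (3 * j + 1 : K)) *
        ∏ j ∈ range n, resolventFactor ζ (w / 2) (3 * j + (2 - w / 2)) := by
  have deformed_eq : deformedSum n (w ^ 5) = 3 ^ (6 * n + 1) * ∑ x ∈ antidiagonal n,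
      clearedDougallTerm (1 / 3) ((1 - w * ζ) / 3) ((1 - w * ζ ^ 2) / 3) ((1 - w * ζ ^ 3) / 3)
        ((1 - w * ζ ^ 4) / 3) x.1 x.2 := by
    rw [deformedSum, mul_sum]
    refine sum_congr rfl fun x hx => ?_
    obtain rfl := mem_antidiagonal.1 hx
    exact deformedTerm_fifth_power hζ (by rw [hw, Nat.cast_add])
  rw [deformed_eq, sum_clearedDougallTerm_fifth_roots hζ hw, prod_resolventFactor,
    ← pow_mul_risingFactorial_div three_ne_zero, ← pow_mul_risingFactorial_div three_ne_zero,
    div_self three_ne_zero]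
  ring

lemma deformedSum_two_mul_add_one {M : ℕ} {q : ℤ} (hq : q = 3 * M + 2) :
    deformedSum (2 * M + 1) ((2 * q) ^ 5) =
      -10 * q ^ 4 * (∏ j ∈ range (2 * M + 1), (3 * j + 3 : ℤ)) *
        (∏ j ∈ range (2 * M + 1), ((2 * q) ^ 2 - (3 * j + 3 : ℤ) ^ 2)) *
        ∏ i ∈ range M, -(((3 * i + 3 : ℤ) ^ 2 - 5 * q ^ 2) *
          ((3 * i + 3) ^ 4 + 10 * q ^ 2 * (3 * i + 3) ^ 2 + 5 * q ^ 4)) := by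
  obtain ⟨ζ, hζ⟩ : ∃ ζ : ℂ, 1 + ζ + ζ ^ 2 + ζ ^ 3 + ζ ^ 4 = 0 :=
    ⟨_, by simpa [sum_range_succ] using
      (Complex.isPrimitiveRoot_exp 5 (by norm_num)).geom_sum_eq_zero (by norm_num)⟩
  have hq' : (q : ℂ) = 3 * M + 2 := by exact_mod_cast hq
  have hw : 2 * (q : ℂ) = 3 * (2 * M + 1 : ℕ) + 1 := by push_cast; linear_combination 2 * hq'
  refine Int.cast_injective (α := ℂ) ?_
  rw [← eq_intCast (Int.castRingHom ℂ), map_deformedSum, eq_intCast]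
  push_cast
  have outer_shift (j : ℕ) : 3 * (j : ℂ) + 1 = 3 * (j - (2 * M + 1 : ℕ)) + 2 * q := by
    rw [hw]; ring
  have inner_shift (j : ℕ) : 3 * (j : ℂ) + (2 - q) = 3 * (j - M) := by rw [hq']; ring
  rw [deformedSum_fifth_power hζ hw, mul_div_cancel_left₀ _ two_ne_zero]
  simp only [outer_shift, inner_shift, prod_three_mul_sub_add_middle,
    prod_resolventFactor_middle hζ, (odd_two_mul_add_one M).neg_one_pow]
  ring

end ClosedForm

section IntegerCongruence

lemma prod_three_mul_add_two {M : ℕ} {q : ℤ} (hq : q = 3 * M + 2) :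
    ∏ j ∈ range (2 * M + 1), (3 * j + 2 : ℤ) = q * ∏ i ∈ range M, (q ^ 2 - (3 * i + 3) ^ 2) := by
  rw [← prod_three_mul_sub_add_middle]
  exact prod_congr rfl fun j _ => by rw [hq]; ring

lemma prod_modEq_neg_one_pow_mul {m : ℤ} {f g : ℕ → ℤ} {e : ℕ}
    (hfg : ∀ i, f i ≡ -g i ^ e [ZMOD m]) (n : ℕ) :
    ∏ i ∈ range n, f i ≡ (-1) ^ n * (∏ i ∈ range n, g i) ^ e [ZMOD m] := by
  rw [← prod_pow, ← card_range n, ← prod_const, card_range, ← prod_mul_distrib]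
  exact Int.ModEq.prod fun i _ => by simpa only [neg_one_mul] using hfg i

-- Both sides carry a factor `q ^ 4`, so the remaining products only matter modulo `q ^ 2`.
theorem deformedSum_zero_modEq {M : ℕ} {q : ℤ} (hq : q = 3 * M + 2) :
    deformedSum (2 * M + 1) 0 ≡
      10 * q * (∏ j ∈ range (2 * M + 1), (3 * j + 2 : ℤ)) ^ 3 *
        (∏ j ∈ range (2 * M + 1), (3 * j + 3 : ℤ)) ^ 3 [ZMOD q ^ 6] := by
  set P : ℤ := ∏ j ∈ range (2 * M + 1), (3 * j + 3 : ℤ)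
  set A : ℤ := ∏ i ∈ range M, (3 * i + 3 : ℤ)
  have deformation : deformedSum (2 * M + 1) 0 ≡ deformedSum (2 * M + 1) ((2 * q) ^ 5)
      [ZMOD q ^ 6] := by
    refine Int.modEq_iff_dvd.2 (dvd_trans ⟨2 ^ 6, ?_⟩ (mul_dvd_deformedSum_sub _ _))
    push_cast
    rw [hq]
    ring
  have outer : ∏ j ∈ range (2 * M + 1), ((2 * q) ^ 2 - (3 * j + 3 : ℤ) ^ 2) ≡
      (-1) ^ (2 * M + 1) * P ^ 2 [ZMOD q ^ 2] :=
    prod_modEq_neg_one_pow_mul (fun j => Int.modEq_iff_dvd.2 ⟨-4, by ring⟩) _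
  have inner : ∏ i ∈ range M, -(((3 * i + 3 : ℤ) ^ 2 - 5 * q ^ 2) *
        ((3 * i + 3) ^ 4 + 10 * q ^ 2 * (3 * i + 3) ^ 2 + 5 * q ^ 4)) ≡
      (-1) ^ M * A ^ 6 [ZMOD q ^ 2] :=
    prod_modEq_neg_one_pow_mul (fun i => Int.modEq_iff_dvd.2
      ⟨5 * (3 * i + 3) ^ 4 - 45 * q ^ 2 * (3 * i + 3) ^ 2 - 25 * q ^ 4, by ring⟩) _
  have right : ∏ i ∈ range M, (q ^ 2 - (3 * i + 3 : ℤ) ^ 2) ≡ (-1) ^ M * A ^ 2 [ZMOD q ^ 2] :=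
    prod_modEq_neg_one_pow_mul (fun i => Int.modEq_iff_dvd.2 ⟨-1, by ring⟩) _
  have sign_sq : ((-1 : ℤ) ^ M) ^ 2 = 1 := by rw [pow_right_comm, neg_one_sq, one_pow]
  have cofactor : -10 * P * (∏ j ∈ range (2 * M + 1), ((2 * q) ^ 2 - (3 * j + 3 : ℤ) ^ 2)) *
        (∏ i ∈ range M, -(((3 * i + 3 : ℤ) ^ 2 - 5 * q ^ 2) *
          ((3 * i + 3) ^ 4 + 10 * q ^ 2 * (3 * i + 3) ^ 2 + 5 * q ^ 4))) ≡
      10 * (∏ i ∈ range M, (q ^ 2 - (3 * i + 3 : ℤ) ^ 2)) ^ 3 * P ^ 3 [ZMOD q ^ 2] :=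
    calc _ ≡ -10 * P * ((-1) ^ (2 * M + 1) * P ^ 2) * ((-1) ^ M * A ^ 6) [ZMOD q ^ 2] :=
          (outer.mul_left _).mul inner
      _ = 10 * ((-1) ^ M * A ^ 2) ^ 3 * P ^ 3 := by
          rw [(odd_two_mul_add_one M).neg_one_pow]
          linear_combination (-10 * P ^ 3 * A ^ 6 * (-1) ^ M) * sign_sq
      _ ≡ _ [ZMOD q ^ 2] := (((right.pow 3).mul_left 10).mul_right _).symm
  refine deformation.trans ?_
  rw [deformedSum_two_mul_add_one hq, prod_three_mul_add_two hq]
  convert cofactor.mul_left' (c := q ^ 4) using 1 <;> ring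

end IntegerCongruence

section PrimeCase

variable {p : ℕ} [Fact p.Prime]

lemma prod_three_mul_add_three_mul_pochRatio {K : Type*} [Field K] [CharZero K] (c : K) (n : ℕ) :
    (∏ j ∈ range n, (3 * j + 3 : K)) * pochRatio (c / 3) n = ∏ j ∈ range n, (3 * j + c : K) := by
  have one_ne : risingFactorial (1 : K) n ≠ 0 := by
    rw [← factorial_eq_risingFactorial_one]
    exact mod_cast n.factorial_ne_zero
  rw [← pow_mul_risingFactorial_div three_ne_zero, ← pow_mul_risingFactorial_div three_ne_zero,
    div_self three_ne_zero, pochRatio, mul_assoc, mul_div_cancel₀ _ one_ne]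

lemma deformedTerm_zero {K : Type*} [Field K] [CharZero K] (k r : ℕ) :
    deformedTerm (0 : K) k r =
      (∏ j ∈ range (k + r), (3 * j + 3 : K)) ^ 6 * ((6 * k + 1) * pochRatio (1 / 3) k ^ 6) := by
  have complement : (∏ j ∈ range k, (3 * j + 3 : K)) * ∏ j ∈ range r, 3 * ((k + r : K) - j) =
      ∏ j ∈ range (k + r), (3 * j + 3 : K) := by
    rw [prod_range_add, ← prod_range_reflect fun j : ℕ => 3 * ((k + r : K) - j)]
    refine congrArg _ (prod_congr rfl fun j hj => ?_)
    rw [Nat.sub_sub, Nat.cast_sub (by have := mem_range.1 hj; lia)]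
    push_cast
    ring
  simp only [deformedTerm, sub_zero, add_zero, ← pow_succ', prod_pow]
  rw [← complement, ← prod_three_mul_add_three_mul_pochRatio]
  ring

lemma pochRatio_one_third_mem_padicMultiples_one (h2 : p % 3 = 2) {k : ℕ} (hk : k < p)
    (hk' : 2 * p < 3 * k + 1) : pochRatio (1 / 3) k ∈ padicMultiples p 1 := by
  have residue := three_mul_negThirdRes_add_one h2 1
  rw [if_pos odd_one, pow_one] at residue
  have bound : 3 * k + 1 ≤ p ^ 2 := by
    obtain ⟨t, rfl⟩ := Nat.exists_eq_add_of_le' (Fact.out : p.Prime).two_le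
    nlinarith
  refine mem_padicMultiples_of_le_padicValRat (pochRatio_pos (by norm_num) k).ne' ?_
  rw [padicValRat_pochRatio_one_third h2 (S := 1) bound, sum_Ico_succ_top le_rfl,
    Ico_self, sum_empty, zero_add, pow_one, Nat.mod_eq_of_lt hk, if_pos (by lia), Nat.cast_one]

lemma pochRatio_two_thirds_mem_padicMultiples_zero (h2 : p % 3 = 2) (k : ℕ) :
    pochRatio (2 / 3) k ∈ padicMultiples p 0 := by
  have bound : 3 * k + 2 ≤ p ^ (3 * k + 2 + 1) :=
    (Nat.lt_succ_self _).le.trans (Nat.lt_pow_self (Fact.out : p.Prime).one_lt).le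
  refine mem_padicMultiples_of_le_padicValRat (pochRatio_pos (by norm_num) k).ne' ?_
  rw [padicValRat_pochRatio_two_thirds h2 bound, Nat.cast_zero]
  exact sum_nonneg fun i _ => by split_ifs <;> norm_num

lemma not_dvd_prod_three_mul_add_three (h2 : p % 3 = 2) {n : ℕ} (hn : n < p) :
    ¬p ∣ ∏ j ∈ range n, (3 * j + 3) := by
  rw [(Fact.out : p.Prime).prime.dvd_finsetProd_iff]
  rintro ⟨j, hj, hdvd⟩
  rw [← mul_add_one, (Fact.out : p.Prime).dvd_mul] at hdvd
  have := mem_range.1 hj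
  exact hdvd.elim (not_dvd_three h2) fun h => by have := Nat.le_of_dvd j.succ_pos h; lia

lemma deformedSum_zero {K : Type*} [Field K] [CharZero K] (n : ℕ) :
    deformedSum n (0 : K) = (∏ j ∈ range n, (3 * j + 3 : K)) ^ 6 *
      ∑ k ∈ range (n + 1), (6 * k + 1) * pochRatio (1 / 3 : K) k ^ 6 := by
  rw [mul_sum, ← Nat.succ_eq_add_one, deformedSum,
    ← Nat.sum_antidiagonal_eq_sum_range_succ fun k _ =>
      (∏ j ∈ range n, (3 * j + 3 : K)) ^ 6 * ((6 * k + 1) * pochRatio (1 / 3 : K) k ^ 6)]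
  refine sum_congr rfl fun x hx => ?_
  rw [deformedTerm_zero, mem_antidiagonal.1 hx]

lemma sum_pochRatio_pow_six_sub_mem_padicMultiples_six {M : ℕ} (hp : p = 3 * M + 2) :
    ∑ k ∈ range (2 * M + 2), (6 * k + 1) * pochRatio (1 / 3 : ℚ) k ^ 6 -
      10 * p * pochRatio (2 / 3 : ℚ) (2 * M + 1) ^ 3 ∈ padicMultiples p 6 := by
  have unit : padicNorm p ((∏ j ∈ range (2 * M + 1), (3 * j + 3 : ℚ)) ^ 6) = 1 := by
    exact_mod_cast padicNorm.nat_eq_one_iff _ |>.2 (mt (Fact.out : p.Prime).dvd_of_dvd_pow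
      (not_dvd_prod_three_mul_add_three (p := p) (by lia) (by lia)))
  have congruence := intCast_mem_padicMultiples.2
    (show ((p ^ 6 : ℕ) : ℤ) ∣ _ by
      exact_mod_cast (deformedSum_zero_modEq (M := M) (q := p) (mod_cast hp)).symm.dvd)
  rw [← mul_mem_padicMultiples_iff unit, mul_sub, ← deformedSum_zero]
  convert congruence using 1
  rw [Int.cast_sub, ← eq_intCast (Int.castRingHom ℚ) (deformedSum _ _), map_deformedSum, map_zero]
  push_cast
  rw [← prod_three_mul_add_three_mul_pochRatio 2]
  ring

theorem sum_pochRatio_sub_mem_padicMultiples_of_prime (h2 : p % 3 = 2) {m n : ℕ}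
    (hn : 3 * n + 1 = 2 * p) (hnm : n ≤ m) (hmp : m < p) :
    ∑ k ∈ range (m + 1), (6 * k + 1) * pochRatio (1 / 3 : ℚ) k ^ 6 -
      10 * p * pochRatio (2 / 3 : ℚ) n ^ 3 ∈ padicMultiples p 6 := by
  obtain ⟨M, hM⟩ : ∃ M, p = 3 * M + 2 := ⟨p / 3, by lia⟩
  obtain rfl : n = 2 * M + 1 := by lia
  have tail_mem : ∑ k ∈ Ico (2 * M + 2) (m + 1), (6 * k + 1) * pochRatio (1 / 3 : ℚ) k ^ 6 ∈
      padicMultiples p 6 := by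
    refine sum_mem fun k hk => ?_
    rw [mem_Ico] at hk
    have coeff := intCast_mem_padicMultiples_zero (p := p) (6 * k + 1)
    have power := pow_mem_padicMultiples
      (pochRatio_one_third_mem_padicMultiples_one h2 (k := k) (by lia) (by lia)) 6
    simpa using mul_mem_padicMultiples coeff power
  rw [← sum_range_add_sum_Ico _ (show 2 * M + 2 ≤ m + 1 by lia), add_sub_right_comm]
  exact add_mem (sum_pochRatio_pow_six_sub_mem_padicMultiples_six hM) tail_mem

end PrimeCase

section MainResult

variable {p : ℕ} [Fact p.Prime]

lemma sum_pochRatio_sub_mem_padicMultiples_of_three_le (h2 : p % 3 = 2) {s m n : ℕ} (hs : Odd s)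
    (hs3 : 3 ≤ s) (hn : 3 * n + 1 = 2 * p ^ s) (hm : m = n ∨ m + 1 = p ^ s) :
    ∑ k ∈ range (m + 1), (6 * k + 1) * pochRatio (1 / 3 : ℚ) k ^ 6 -
      10 * p ^ s * pochRatio (2 / 3 : ℚ) n ^ 3 ∈ padicMultiples p (s + 5) := by
  have right_eq : 10 * p ^ s * pochRatio (2 / 3 : ℚ) n ^ 3 = (5 : ℕ) • dualTerm 0 n := by
    have hn' : (3 * n + 1 : ℚ) = 2 * p ^ s := mod_cast hn
    rw [dualTerm, dualBase_zero_left, nsmul_eq_mul]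
    push_cast
    linear_combination (-5 * pochRatio (2 / 3 : ℚ) n ^ 3) * hn'
  have right_mem := dualTerm_mem_padicMultiples h2 (k := 0) (r := n) hs hs3 (by lia)
  rw [sum_pochRatio_pow_six, right_eq]
  refine sub_mem (sum_mem fun x hx => ?_) (nsmul_mem right_mem 5)
  obtain rfl := mem_antidiagonal.1 hx
  exact dualTerm_mem_padicMultiples h2 hs hs3 (hm.imp_left fun h => by rw [h, hn])

theorem sum_pochRatio_sub_mem_padicMultiples (h2 : p % 3 = 2) {s m n : ℕ} (hs : Odd s)
    (hn : 3 * n + 1 = 2 * p ^ s) (hm : m = n ∨ m + 1 = p ^ s) :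
    ∑ k ∈ range (m + 1), (6 * k + 1) * pochRatio (1 / 3 : ℚ) k ^ 6 -
      10 * p ^ s * pochRatio (2 / 3 : ℚ) n ^ 3 ∈ padicMultiples p (s + 5) := by
  obtain rfl | hs3 : s = 1 ∨ 3 ≤ s := by grind
  · simp only [pow_one] at hn hm ⊢
    exact sum_pochRatio_sub_mem_padicMultiples_of_prime h2 hn (by lia) (by lia)
  · exact sum_pochRatio_sub_mem_padicMultiples_of_three_le h2 hs hs3 hn hm

lemma mod_three_eq_two_of_pow_modEq {q s : ℕ} (h : q ^ s ≡ 2 [MOD 3]) : q % 3 = 2 ∧ Odd s := by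
  have h2 : q % 3 = 2 := by
    rw [Nat.ModEq, Nat.pow_mod] at h
    obtain h0 | h1 | h2 : q % 3 = 0 ∨ q % 3 = 1 ∨ q % 3 = 2 := by lia
    · cases s <;> simp [h0] at h
    · simp [h1] at h
    · exact h2
  have := pow_mod_three h2 s
  grind [Nat.ModEq]

end MainResult

theorem corollary1p6_general (p s : ℕ) (hp : p.Prime) (hmod : p ^ s ≡ 2 [MOD 3]) (m : ℕ)
    (hm : m = (2 * p ^ s - 1) / 3 ∨ m = p ^ s - 1) :
    RatModEq (p ^ (s + 5))
      (∑ k ∈ Finset.range (m + 1),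
        (6 * (k : ℚ) + 1) * (shiftedFactorial (1 / 3) k ^ 6 / (k.factorial : ℚ) ^ 6))
      (10 * (p : ℚ) ^ s *
        (shiftedFactorial (2 / 3) ((2 * p ^ s - 1) / 3) ^ 3 /
          shiftedFactorial 1 ((2 * p ^ s - 1) / 3) ^ 3)) := by
  have : Fact p.Prime := ⟨hp⟩
  obtain ⟨h2, hs⟩ := mod_three_eq_two_of_pow_modEq hmod
  have hpos := pow_pos hp.pos s
  have hn : 3 * ((2 * p ^ s - 1) / 3) + 1 = 2 * p ^ s := by rw [Nat.ModEq] at hmod; lia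
  have right_mem : 10 * (p : ℚ) ^ s * pochRatio (2 / 3) ((2 * p ^ s - 1) / 3) ^ 3 ∈
      padicMultiples p 0 := by
    simpa using mul_mem_padicMultiples (intCast_mem_padicMultiples_zero (10 * p ^ s))
      (pow_mem_padicMultiples (pochRatio_two_thirds_mem_padicMultiples_zero h2 _) 3)
  simp only [shiftedFactorial_eq_risingFactorial, factorial_eq_risingFactorial_one, ← div_pow]
  exact ratModEq_of_mem_padicMultiples right_mem
    (sum_pochRatio_sub_mem_padicMultiples h2 hs hn (by lia))

/-- The natural-number quotient `(2 * p ^ s - 1) / 3` is exact, because `p ^ s ≡ 2 (mod 3)`. -/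
theorem corollary1p6 (p s : ℕ) (hp : p.Prime) (hodd : Odd p) (hs : 0 < s)
    (hmod : p ^ s ≡ 2 [MOD 3]) (m : ℕ)
    (hm : m = (2 * p ^ s - 1) / 3 ∨ m = p ^ s - 1) :
    RatModEq (p ^ (s + 5))
      (∑ k ∈ Finset.range (m + 1),
        (6 * (k : ℚ) + 1) * (shiftedFactorial (1 / 3) k ^ 6 / (k.factorial : ℚ) ^ 6))
      (10 * (p : ℚ) ^ s *
        (shiftedFactorial (2 / 3) ((2 * p ^ s - 1) / 3) ^ 3 /
          shiftedFactorial 1 ((2 * p ^ s - 1) / 3) ^ 3)) :=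
  corollary1p6_general p s hp hmod m hm
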